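/- \textbf{Setting.} Let $k\ge 2$, let $\mathcal C$ be a finite set of classes, let $f_1,\dots,f_k:\mathcal X\to\mathcal C$ be (measurable) classifiers, and let $(x_t,c_t)_{t\ge1}$ be i.i.d. from a probability distribution on $\mathcal X\times\mathcal C$. Write $\ell_{t,i}=\mathbf 1\{f_i(x_t)\ne c_t\}$. Assume there is a unique best model $i^*$, that is, $\Delta_j:=\mathbb E[\ell_{1,j}-\ell_{1,i^*}]>0$ for all $j\ne i^*$. Let $\theta_j:=\Pr\{\ell_{1,j}\ne\ell_{1,i^*}\}$ and $\lambda:=\min_{j\ne i^*}\Delta_j^2/\theta_j$. \textbf{Algorithm (Model Picker).} Put $\widehat L_{0,i}=0$ for all $i$. In round $t=1,2,\dots$, let $\eta_t=\sqrt{\log k/(2t)}$ and $w_{t,i}=e^{-\eta_t\widehat L_{t-1,i}}/\sum_j e^{-\eta_t\widehat L_{t-1,j}}$. Recommend some $\pi_t\in\arg\max_i w_{t,i}$, where ties are broken in any way that uses only information independent of $(x_t,c_t)$ (the past and, possibly, extra randomization). Predict with a model $I_t$. Put $$v_t=\max_{c\in\mathcal C} r_{t,c}(1-r_{t,c}),\qquad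 r_{t,c}=\sum_{i} w_{t,i}\mathbf 1\{f_i(x_t)\ne c\},$$ and let $q_t=\min\{1,\max\{v_t,\eta_t\}\}$ if $v_t\neq0$ and $q_t=0$ if $v_t=0$. Given the past and $(x_t,c_t)$, draw $Q_t\sim\mathrm{Ber}(q_t)$. If $Q_t=1$, query $c_t$ and set $\widehat L_{t,i}=\widehat L_{t-1,i}+\ell_{t,i}/q_t$ for all $i$; otherwise set $\widehat L_t=\widehat L_{t-1}$. \textbf{Theorem (Regret bound, stochastic streams, Follow The Leader).} If $I_t=\pi_t$ for all $t\ge1$, then for every $T$ the pseudo-regret $R_T:=\mathbb E\big[\sum_{t=1}^T\ell_{t,I_t}\big]-T\,\mathbb E[\ell_{1,i^*}]$ is bounded by a constant independent of $T$: $$R_T\;\le\;62\cdot\frac{k}{\lambda^2\log k}\,\max_{i}\Delta_i .$$ -/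

import Mathlib

open MeasureTheory ProbabilityTheory
open scoped BigOperators

namespace ModelPicker

noncomputable section

/-- The 0-1 loss of predicting the label `a` when the true label is `c`. -/
def zeroOne {C : Type*} (a c : C) : ℝ :=
  open Classical in if a ≠ c then 1 else 0

/-- The loss of expert `i` on the labelled instance `z = (x, c)`. -/
def loss {X C : Type*} {k : ℕ} (f : Fin k → X → C) (i : Fin k) (z : X × C) : ℝ :=
  zeroOne (f i z.1) z.2

/-- The decaying learning rate `η_t = √(log k / (2 t))`. -/
def learningRate (k t : ℕ) : ℝ := Real.sqrt (Real.log k / (2 * t))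

/-- Exponential weights: `w_i ∝ exp (-η L_i)`, normalised to a probability vector. -/
def expWeights {k : ℕ} (η : ℝ) (L : Fin k → ℝ) (i : Fin k) : ℝ :=
  Real.exp (-η * L i) / ∑ j, Real.exp (-η * L j)

/-- `⟨w, ℓ^(c)⟩`: the mean under `w` of the hypothetical loss vector if the true label were `c`. -/
def meanLoss {C : Type*} {k : ℕ} (p : Fin k → C) (w : Fin k → ℝ) (c : C) : ℝ :=
  ∑ i, w i * zeroOne (p i) c

/-- `v(p, w)`: the largest variance under `w`, over all labels `c`, of the hypothetical loss. -/
def maxVariance {C : Type*} {k : ℕ} (p : Fin k → C) (w : Fin k → ℝ) : ℝ :=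
  ⨆ c : C, meanLoss p w c * (1 - meanLoss p w c)

/-- The query probability: `0` if `v(p, w) = 0`, and `v(p, w) ∨ η` otherwise. Since `η` can
exceed `1` in the first few rounds, the value is capped at `1`. -/
def queryProb {C : Type*} {k : ℕ} (η : ℝ) (p : Fin k → C) (w : Fin k → ℝ) : ℝ :=
  open Classical in if maxVariance p w = 0 then 0 else min 1 (max (maxVariance p w) η)

/-- The weights `w_t`, as a function of the cumulative estimated loss `L = L̂_{t-1}`. -/
def roundWeights {k : ℕ} (t : ℕ) (L : Fin k → ℝ) : Fin k → ℝ :=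
  expWeights (learningRate k t) L

/-- The query probability `q_t` on the input `x = x_t`, as a function of `L = L̂_{t-1}`. -/
def roundQueryProb {X C : Type*} {k : ℕ} (f : Fin k → X → C) (t : ℕ) (L : Fin k → ℝ) (x : X) :
    ℝ :=
  queryProb (learningRate k t) (fun i => f i x) (roundWeights t L)

/-- The cumulative estimated losses `L̂_t` along the stream `z` with query decisions `b`
(rounds are numbered `1, 2, …`; the values `z 0`, `b 0` are not used). -/
def estLoss {X C : Type*} {k : ℕ} (f : Fin k → X → C) (z : ℕ → X × C) (b : ℕ → Bool) :
    ℕ → Fin k → ℝ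
  | 0 => fun _ => 0
  | t + 1 => fun i => estLoss f z b t i +
      if b (t + 1) then loss f i (z (t + 1)) / roundQueryProb f (t + 1) (estLoss f z b t) (z (t + 1)).1
      else 0

/-- A run of the algorithm on an i.i.d. stream with law `D`. `Z t = (x_t, c_t)` is the labelled
instance, `Q t` the query decision and `π t` the recommendation of round `t ≥ 1`, and `ℱ t`
is the information generated by the stream and the learner in rounds `1, …, t` (it may contain
additional randomness used to break ties). -/
structure IsRun {X C Ω : Type*} [MeasurableSpace X] [MeasurableSpace C] [mΩ : MeasurableSpace Ω]
    {k : ℕ} (f : Fin k → X → C) (D : Measure (X × C)) (P : Measure Ω) (ℱ : Filtration ℕ mΩ)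
    (Z : ℕ → Ω → X × C) (Q : ℕ → Ω → Bool) (π : ℕ → Ω → Fin k) : Prop where
  measurable_Z : ∀ t, Measurable[ℱ (t + 1)] (Z (t + 1))
  measurable_Q : ∀ t, Measurable[ℱ (t + 1)] (Q (t + 1))
  /-- each labelled instance has law `D` … -/
  law_Z : ∀ t, P.map (Z (t + 1)) = D
  /-- … and is independent of all that happened in earlier rounds. -/
  indep_Z : ∀ t, Indep (MeasurableSpace.comap (Z (t + 1)) inferInstance) (ℱ t) P
  /-- given the past and the current instance, `Q_t` is Bernoulli with parameter `q_t`. -/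
  law_Q : ∀ t,
    P[fun ω => if Q (t + 1) ω then (1 : ℝ) else 0 |
        (ℱ t : MeasurableSpace Ω) ⊔ MeasurableSpace.comap (Z (t + 1)) inferInstance]
      =ᵐ[P] fun ω =>
        roundQueryProb f (t + 1) (estLoss f (fun s => Z s ω) (fun s => Q s ω) t) (Z (t + 1) ω).1
  /-- the recommendation depends on the past only (up to the breaking of ties) … -/
  measurable_π : ∀ t, Measurable[ℱ t] (π (t + 1))
  /-- … and maximises the weights `w_t`. -/
  argmax_π : ∀ t ω i,
    roundWeights (t + 1) (estLoss f (fun s => Z s ω) (fun s => Q s ω) t) i ≤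
      roundWeights (t + 1) (estLoss f (fun s => Z s ω) (fun s => Q s ω) t) (π (t + 1) ω)

/-- The expected loss (error probability) of expert `i` under `D`. -/
def risk {X C : Type*} [MeasurableSpace X] [MeasurableSpace C] {k : ℕ}
    (f : Fin k → X → C) (D : Measure (X × C)) (i : Fin k) : ℝ :=
  ∫ z, loss f i z ∂D

/-- `Δ_j = E[ℓ_j - ℓ_{i*}]`. -/
def gap {X C : Type*} [MeasurableSpace X] [MeasurableSpace C] {k : ℕ}
    (f : Fin k → X → C) (D : Measure (X × C)) (istar j : Fin k) : ℝ :=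
  ∫ z, (loss f j z - loss f istar z) ∂D

/-- `θ_j = P(ℓ_j ≠ ℓ_{i*})`. -/
def disagreement {X C : Type*} [MeasurableSpace X] [MeasurableSpace C] {k : ℕ}
    (f : Fin k → X → C) (D : Measure (X × C)) (istar j : Fin k) : ℝ :=
  D.real {z | loss f j z ≠ loss f istar z}

/-- `λ = min_{j ≠ i*} Δ_j² / θ_j`. -/
def hardness {X C : Type*} [MeasurableSpace X] [MeasurableSpace C] {k : ℕ}
    (f : Fin k → X → C) (D : Measure (X × C)) (istar : Fin k) : ℝ :=
  ⨅ j : {j : Fin k // j ≠ istar}, gap f D istar j ^ 2 / disagreement f D istar j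

/-- The pseudo-regret `R_T = E[∑_{t ≤ T} ℓ_{t, I_t}] - T · E[ℓ_{i*}]` of the predictions `I`. -/
def pseudoRegret {X C Ω : Type*} [MeasurableSpace X] [MeasurableSpace C] [MeasurableSpace Ω]
    {k : ℕ} (f : Fin k → X → C) (D : Measure (X × C)) (P : Measure Ω)
    (Z : ℕ → Ω → X × C) (I : ℕ → Ω → Fin k) (istar : Fin k) (T : ℕ) : ℝ :=
  (∫ ω, ∑ t ∈ Finset.Icc 1 T, loss f (I t ω) (Z t ω) ∂P) - T * risk f D istar

end

end ModelPicker

/-! Constant regret follows once the probability of recommending a wrong model in round `t + 1` is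
summable in `t`. Recommending `j ≠ i*` forces `L̂_{t,j} - L̂_{t,i*} ≤ 0`, while this difference has
mean `t Δ_j`, so a lower-tail bound is needed.

The difference is a sum of importance-weighted terms `d/q`, each kept with conditional probability
`q`, where `d = ℓ_j - ℓ_{i*}`. If the two models disagree then `q ≥ min 1 η_s ≥ β`, with `β = η_t`
once `η_t ≤ 1`; if they agree then `d = 0`. Each term is thus at most `1/β` in absolute value and
has conditional second moment at most `d²/β`, whose mean is `θ_j/β`. A Bernstein-type exponential
moment argument (`IsRun.integral_exp_estExcess_succ_le`, `IsRun.measure_estExcess_nonpos_le`) bounds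
the tail by `exp(-t η_t λ / 3)`.

Since `t η_t = √(log k / 2) √t`, summing `k e^{-c√t}` with `c = λ √(log k / 2) / 3` gives at most
`2k/c² = 36 k/(λ² log k)`. Rounds with `2t < log k` are charged 1 each, at most `26 k/(λ² log k)` in
total. This explains `62 = 36 + 26`; each wrong recommendation costs at most `max Δ_i`. -/

namespace ModelPicker

/-! ### Query probabilities and scalar inequalities -/

section Deterministic

variable {X C : Type*} {k : ℕ}

lemma zeroOne_eq_zero_or_one (a c : C) : zeroOne a c = 0 ∨ zeroOne a c = 1 := by
  unfold zeroOne; split_ifs <;> simp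

lemma zeroOne_nonneg (a c : C) : 0 ≤ zeroOne a c := by
  rcases zeroOne_eq_zero_or_one a c with h | h <;> simp [h]

lemma zeroOne_le_one (a c : C) : zeroOne a c ≤ 1 := by
  rcases zeroOne_eq_zero_or_one a c with h | h <;> simp [h]

lemma zeroOne_self (a : C) : zeroOne a a = 0 := by simp [zeroOne]

lemma zeroOne_of_ne {a c : C} (h : a ≠ c) : zeroOne a c = 1 := by simp [zeroOne, h]

/-- The excess loss `ℓ_j - ℓ_i` on an instance. -/
noncomputable def excess (f : Fin k → X → C) (i j : Fin k) (z : X × C) : ℝ := loss f j z - loss f i z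

lemma abs_excess_le_one (f : Fin k → X → C) (i j : Fin k) (z : X × C) :
    |excess f i j z| ≤ 1 := by
  unfold excess loss
  rcases zeroOne_eq_zero_or_one (f j z.1) z.2 with h | h <;>
  rcases zeroOne_eq_zero_or_one (f i z.1) z.2 with h' | h' <;> simp [h, h']

lemma excess_sq (f : Fin k → X → C) (i j : Fin k) (z : X × C) :
    excess f i j z ^ 2 = Set.indicator {z | loss f j z ≠ loss f i z} (fun _ => (1 : ℝ)) z := by
  unfold excess loss
  rcases zeroOne_eq_zero_or_one (f j z.1) z.2 with h | h <;>
  rcases zeroOne_eq_zero_or_one (f i z.1) z.2 with h' | h' <;> simp [h, h', Set.indicator]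

lemma expWeights_pos (η : ℝ) (L : Fin k → ℝ) (i : Fin k) : 0 < expWeights η L i :=
  div_pos (Real.exp_pos _)
    (Finset.sum_pos (fun _ _ => Real.exp_pos _) ⟨i, Finset.mem_univ i⟩)

lemma sum_expWeights [Nonempty (Fin k)] (η : ℝ) (L : Fin k → ℝ) :
    ∑ i, expWeights η L i = 1 := by
  unfold expWeights
  rw [← Finset.sum_div, div_self]
  exact (Finset.sum_pos (fun _ _ => Real.exp_pos _) Finset.univ_nonempty).ne'

/-- For the label `p j`, expert `i` errs and expert `j` does not. Both have positive weight, so the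
mean loss lies strictly between 0 and 1. -/
lemma maxVariance_pos_of_ne [Finite C] {p : Fin k → C} {w : Fin k → ℝ} (hw : ∀ i, 0 < w i)
    (hw1 : ∑ i, w i = 1) {i j : Fin k} (hij : p i ≠ p j) : 0 < maxVariance p w := by
  have h1 : 0 < meanLoss p w (p j) := by
    refine Finset.sum_pos' (fun m _ => mul_nonneg (hw m).le (zeroOne_nonneg _ _))
      ⟨i, Finset.mem_univ i, ?_⟩
    rw [zeroOne_of_ne hij, mul_one]; exact hw i
  have h2 : 0 < 1 - meanLoss p w (p j) := by
    rw [← hw1, meanLoss, ← Finset.sum_sub_distrib]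
    refine Finset.sum_pos' (fun m _ => ?_) ⟨j, Finset.mem_univ j, ?_⟩
    · nlinarith [hw m, zeroOne_le_one (p m) (p j)]
    · rw [zeroOne_self, mul_zero, sub_zero]; exact hw j
  exact (mul_pos h1 h2).trans_le
    (le_ciSup (f := fun c => meanLoss p w c * (1 - meanLoss p w c))
      (Set.finite_range _).bddAbove (p j))

lemma min_le_queryProb_of_ne [Finite C] {η : ℝ} {p : Fin k → C} {w : Fin k → ℝ}
    (hw : ∀ i, 0 < w i) (hw1 : ∑ i, w i = 1) {i j : Fin k} (hij : p i ≠ p j) :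
    min 1 η ≤ queryProb η p w := by
  rw [queryProb, if_neg (maxVariance_pos_of_ne hw hw1 hij).ne']
  exact min_le_min le_rfl (le_max_right _ _)

/-- Either two experts suffer the same loss, or the query probability is at least `min 1 η_t`. -/
lemma excess_eq_zero_or_le_roundQueryProb [Finite C] (f : Fin k → X → C) (i j : Fin k) (t : ℕ)
    (L : Fin k → ℝ) (z : X × C) :
    excess f i j z = 0 ∨ min 1 (learningRate k t) ≤ roundQueryProb f t L z.1 := by
  -- Equal predictions cancel in the excess for every label, so a vanishing query probability does
  -- no harm.
  by_cases h : f i z.1 = f j z.1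
  · left; simp [excess, loss, h]
  · right
    have : Nonempty (Fin k) := ⟨i⟩
    exact min_le_queryProb_of_ne (expWeights_pos _ _) (sum_expWeights _ _) h

lemma learningRate_anti {s t : ℕ} (hs : 0 < s) (hst : s ≤ t) :
    learningRate k t ≤ learningRate k s := by
  have : (0 : ℝ) < s := by exact_mod_cast hs
  have h2 : (s : ℝ) ≤ t := by exact_mod_cast hst
  exact Real.sqrt_le_sqrt (div_le_div_of_nonneg_left (Real.log_natCast_nonneg k)
    (by positivity) (by linarith))

/-- The left side is `E[e^{-aY} - 1]` for `Y` equal to `d/q` with probability `q` and 0 otherwise.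
Since `a ≤ β ≤ q`, the exponent stays in `[-1, 1]`, where `e^y ≤ 1 + y + 3/4 y²`. -/
lemma mul_exp_div_sub_one_le {β q d a : ℝ} (hβ : 0 < β) (hd : |d| ≤ 1) (ha : 0 ≤ a) (haβ : a ≤ β)
    (hq : d = 0 ∨ β ≤ q) :
    (Real.exp (-a * (d / q)) - 1) * q ≤ -a * d + 3 / 4 * a ^ 2 / β * d ^ 2 := by
  rcases hq with rfl | hq
  · simp
  have hq0 : 0 < q := hβ.trans_le hq
  have hy : |-a * (d / q)| ≤ 1 := by
    rw [abs_mul, abs_neg, abs_div, abs_of_nonneg ha, abs_of_pos hq0, ← mul_div_assoc,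
      div_le_one hq0]
    nlinarith [abs_nonneg d]
  have h := (abs_le.1 (Real.exp_bound hy (n := 2) (by norm_num))).2
  simp only [Finset.sum_range_succ, Finset.sum_range_zero, sq_abs] at h
  norm_num [Nat.factorial] at h
  have h2 : Real.exp (-a * (d / q)) - 1 ≤ -a * (d / q) + 3 / 4 * a ^ 2 * d ^ 2 / q ^ 2 := by
    have : (a * (d / q)) ^ 2 * (3 / 4) = 3 / 4 * a ^ 2 * d ^ 2 / q ^ 2 := by
      rw [mul_pow, div_pow]; ring
    rw [neg_mul]
    linarith
  calc _ ≤ (-a * (d / q) + 3 / 4 * a ^ 2 * d ^ 2 / q ^ 2) * q :=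
        mul_le_mul_of_nonneg_right h2 hq0.le
    _ = -a * d + 3 / 4 * a ^ 2 * d ^ 2 / q := by field_simp
    _ ≤ -a * d + 3 / 4 * a ^ 2 * d ^ 2 / β := by gcongr
    _ = _ := by ring

/-- The function `(2 / c²) (c √t + 1) e^{-c √t}` is a telescoping majorant of `e^{-c √t}`. -/
lemma exp_neg_mul_sqrt_le_sub {c : ℝ} (hc : 0 < c) (t : ℕ) :
    Real.exp (-(c * √((t + 1 : ℕ) : ℝ))) ≤
      2 / c ^ 2 * ((c * √(t : ℝ) + 1) * Real.exp (-(c * √(t : ℝ)))) -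
      2 / c ^ 2 * ((c * √((t + 1 : ℕ) : ℝ) + 1) * Real.exp (-(c * √((t + 1 : ℕ) : ℝ)))) := by
  -- The majorant comes from calculus: `(2/c²)(c√x + 1)e^{-c√x}` has derivative `-e^{-c√x}`.
  set u := c * √(t : ℝ) with hu
  set v := c * √((t + 1 : ℕ) : ℝ) with hv
  have hu0 : 0 ≤ u := by positivity
  have huv : u ≤ v := by
    refine mul_le_mul_of_nonneg_left (Real.sqrt_le_sqrt ?_) hc.le
    push_cast; linarith
  have hsq : v ^ 2 - u ^ 2 = c ^ 2 := by
    rw [hu, hv, mul_pow, mul_pow, Real.sq_sqrt (by positivity), Real.sq_sqrt (by positivity)]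
    push_cast; ring
  have he : Real.exp (-u) = Real.exp (v - u) * Real.exp (-v) := by
    rw [← Real.exp_add]; ring_nf
  have hq := Real.quadratic_le_exp_of_nonneg (sub_nonneg.2 huv)
  -- With `δ = v - u` and `e^δ ≥ 1 + δ + δ²/2`, the right side is at least `2uδ + (u + 1)δ² = c² +
  -- uδ²`.
  have key : c ^ 2 ≤ 2 * ((u + 1) * Real.exp (v - u) - (v + 1)) := by
    have h1 := mul_le_mul_of_nonneg_left hq (by linarith : 0 ≤ u + 1)
    nlinarith [mul_nonneg hu0 (sq_nonneg (v - u))]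
  rw [he, ← mul_sub]
  have : (u + 1) * (Real.exp (v - u) * Real.exp (-v)) - (v + 1) * Real.exp (-v)
    = ((u + 1) * Real.exp (v - u) - (v + 1)) * Real.exp (-v) := by ring
  rw [this, ← mul_assoc]
  refine le_mul_of_one_le_left (Real.exp_pos _).le ?_
  rw [div_mul_eq_mul_div, one_le_div (by positivity)]
  exact key

lemma sum_exp_neg_mul_sqrt_le {c : ℝ} (hc : 0 < c) (n : ℕ) :
    ∑ t ∈ Finset.range n, Real.exp (-(c * √((t + 1 : ℕ) : ℝ))) ≤ 2 / c ^ 2 := by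
  refine (Finset.sum_le_sum fun t _ => exp_neg_mul_sqrt_le_sub hc t).trans ?_
  rw [Finset.sum_range_sub' (fun t : ℕ =>
    2 / c ^ 2 * ((c * √(t : ℝ) + 1) * Real.exp (-(c * √(t : ℝ)))))]
  simp only [Nat.cast_zero, Real.sqrt_zero, mul_zero, neg_zero, Real.exp_zero, zero_add, mul_one]
  have : 0 ≤ 2 / c ^ 2 * ((c * √(n : ℝ) + 1) * Real.exp (-(c * √(n : ℝ)))) := by positivity
  linarith

end Deterministic

/-! ### Measurability of losses, query probabilities and updates -/

section Measurability

variable {X C : Type*} [MeasurableSpace X] [MeasurableSpace C] {k : ℕ}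

lemma measurable_zeroOne_comp [MeasurableSingletonClass C] {g : X → C} (hg : Measurable g)
    (c : C) : Measurable fun x => zeroOne (g x) c := by
  classical
  unfold zeroOne
  refine Measurable.ite ?_ measurable_const measurable_const
  exact (hg (measurableSet_singleton c)).compl

lemma measurable_loss [Countable C] [MeasurableSingletonClass C] {f : Fin k → X → C}
    (hf : ∀ i, Measurable (f i)) (i : Fin k) : Measurable (loss f i) := by
  classical
  unfold loss zeroOne
  refine Measurable.ite ?_ measurable_const measurable_const
  exact (measurableSet_eq_fun ((hf i).comp measurable_fst) measurable_snd).compl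

lemma measurable_excess [Countable C] [MeasurableSingletonClass C] {f : Fin k → X → C}
    (hf : ∀ i, Measurable (f i)) (i j : Fin k) : Measurable (excess f i j) :=
  (measurable_loss hf j).sub (measurable_loss hf i)

lemma measurable_roundQueryProb [Finite C] [MeasurableSingletonClass C] {f : Fin k → X → C}
    (hf : ∀ i, Measurable (f i)) (t : ℕ) :
    Measurable fun p : (Fin k → ℝ) × X => roundQueryProb f t p.1 p.2 := by
  classical
  have hw : ∀ i, Measurable fun p : (Fin k → ℝ) × X => roundWeights t p.1 i := by
    intro i
    unfold roundWeights expWeights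
    fun_prop
  have hm : ∀ c, Measurable fun p : (Fin k → ℝ) × X =>
      meanLoss (fun i => f i p.2) (roundWeights t p.1) c := fun c =>
    Finset.measurable_sum _ fun i _ =>
      (hw i).mul ((measurable_zeroOne_comp (hf i) c).comp measurable_snd)
  have hv : Measurable fun p : (Fin k → ℝ) × X =>
      maxVariance (fun i => f i p.2) (roundWeights t p.1) :=
    Measurable.iSup fun c => (hm c).mul (measurable_const.sub (hm c))
  unfold roundQueryProb queryProb
  exact Measurable.ite (hv (measurableSet_singleton 0)) measurable_const
    (measurable_const.min (hv.max measurable_const))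

lemma measurable_roundQueryProb_comp [Finite C] [MeasurableSingletonClass C]
    {f : Fin k → X → C} (hf : ∀ i, Measurable (f i)) (t : ℕ) {Ω : Type*} {m : MeasurableSpace Ω}
    {L : Ω → Fin k → ℝ} {z : Ω → X × C} (hL : Measurable L) (hz : Measurable z) :
    Measurable fun ω => roundQueryProb f t (L ω) (z ω).1 := by
  have h : Measurable fun ω => (L ω, (z ω).1) := hL.prodMk hz.fst
  have h2 := (measurable_roundQueryProb hf t).comp h
  simpa only [Function.comp_def] using h2

lemma measurable_estLoss_update [Finite C] [MeasurableSingletonClass C]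
    {f : Fin k → X → C} (hf : ∀ i, Measurable (f i)) (t : ℕ) {Ω : Type*} {m : MeasurableSpace Ω}
    {L : Ω → Fin k → ℝ} {z : Ω → X × C} {b : Ω → Bool} (hL : Measurable L) (hz : Measurable z)
    (hb : Measurable b) :
    Measurable fun ω => fun i => L ω i +
      if b ω then loss f i (z ω) / roundQueryProb f t (L ω) (z ω).1 else 0 := by
  refine measurable_pi_lambda _ fun i => ?_
  refine ((measurable_pi_apply i).comp hL).add ?_
  refine Measurable.ite (hb (measurableSet_singleton true)) ?_ measurable_const
  exact ((measurable_loss hf i).comp hz).div (measurable_roundQueryProb_comp hf t hL hz)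

end Measurability

/-! ### Estimated losses along a run and their concentration -/

section Run

variable {X C Ω : Type*} [MeasurableSpace X] [Finite C] [MeasurableSpace C]
    [MeasurableSingletonClass C] [mΩ : MeasurableSpace Ω] {k : ℕ} {f : Fin k → X → C}
    {D : Measure (X × C)} {P : Measure Ω} [IsProbabilityMeasure P]
    {ℱ : Filtration ℕ mΩ} {Z : ℕ → Ω → X × C} {Q : ℕ → Ω → Bool} {π : ℕ → Ω → Fin k}

/-- The difference `L̂_{t,j} - L̂_{t,i}` of the cumulative estimated losses along a run. -/
noncomputable def estExcess (f : Fin k → X → C) (Z : ℕ → Ω → X × C) (Q : ℕ → Ω → Bool)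
    (i j : Fin k) (t : ℕ) (ω : Ω) : ℝ :=
  estLoss f (fun s => Z s ω) (fun s => Q s ω) t j -
    estLoss f (fun s => Z s ω) (fun s => Q s ω) t i

/-- The query probability of round `t + 1` along a run. -/
noncomputable def nextQueryProb (f : Fin k → X → C) (Z : ℕ → Ω → X × C) (Q : ℕ → Ω → Bool)
    (t : ℕ) (ω : Ω) : ℝ :=
  roundQueryProb f (t + 1) (estLoss f (fun s => Z s ω) (fun s => Q s ω) t) (Z (t + 1) ω).1

omit [MeasurableSpace X] [Finite C] [MeasurableSpace C] [MeasurableSingletonClass C] mΩ in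
lemma estExcess_zero (i j : Fin k) (ω : Ω) : estExcess f Z Q i j 0 ω = 0 := by
  simp [estExcess, estLoss]

omit [MeasurableSpace X] [Finite C] [MeasurableSpace C] [MeasurableSingletonClass C] mΩ in
lemma estExcess_succ (i j : Fin k) (t : ℕ) (ω : Ω) :
    estExcess f Z Q i j (t + 1) ω = estExcess f Z Q i j t ω +
      if Q (t + 1) ω then excess f i j (Z (t + 1) ω) / nextQueryProb f Z Q t ω else 0 := by
  simp only [estExcess, estLoss, excess, nextQueryProb]
  split_ifs <;> ring

omit [MeasurableSpace X] [MeasurableSpace C] [MeasurableSingletonClass C] mΩ in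
-- This bound and the next serve only to make the exponentials bounded, hence integrable.
lemma abs_excess_div_nextQueryProb_le {β : ℝ} (hβ : 0 < β) {t : ℕ}
    (ht : β ≤ min 1 (learningRate k (t + 1))) (i j : Fin k) (ω : Ω) :
    |excess f i j (Z (t + 1) ω) / nextQueryProb f Z Q t ω| ≤ 1 / β := by
  rcases excess_eq_zero_or_le_roundQueryProb f i j (t + 1)
    (estLoss f (fun s => Z s ω) (fun s => Q s ω) t) (Z (t + 1) ω) with h | h
  · rw [h, zero_div, abs_zero]; positivity
  · have hq : β ≤ nextQueryProb f Z Q t ω := ht.trans h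
    rw [abs_div, abs_of_pos (hβ.trans_le hq)]
    exact div_le_div₀ zero_le_one (abs_excess_le_one _ _ _ _) hβ hq

omit [MeasurableSpace X] [MeasurableSpace C] [MeasurableSingletonClass C] mΩ in
lemma abs_estExcess_le {β : ℝ} (hβ : 0 < β) (i j : Fin k) (ω : Ω) (t : ℕ)
    (ht : ∀ s < t, β ≤ min 1 (learningRate k (s + 1))) :
    |estExcess f Z Q i j t ω| ≤ t / β := by
  induction t with
  | zero => simp [estExcess_zero]
  | succ t ih =>
    have h1 := ih fun s hs => ht s (hs.trans t.lt_succ_self)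
    have h2 := abs_excess_div_nextQueryProb_le (f := f) (Z := Z) (Q := Q) hβ
      (ht t t.lt_succ_self) i j ω
    rw [estExcess_succ]
    refine (abs_add_le _ _).trans ?_
    push_cast
    rw [add_div]
    refine add_le_add h1 ?_
    split_ifs
    · exact h2
    · rw [abs_zero]; positivity

omit [IsProbabilityMeasure P] in
lemma IsRun.measurable_estLoss (hf : ∀ i, Measurable (f i)) (hrun : IsRun f D P ℱ Z Q π)
    (t : ℕ) :
    Measurable[ℱ t] fun ω => estLoss f (fun s => Z s ω) (fun s => Q s ω) t := by
  induction t with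
  | zero => exact measurable_const
  | succ t ih =>
    exact measurable_estLoss_update hf (t + 1) (ih.mono (ℱ.mono t.le_succ) le_rfl)
      (hrun.measurable_Z t) (hrun.measurable_Q t)

omit [IsProbabilityMeasure P] in
lemma IsRun.measurable_estExcess (hf : ∀ i, Measurable (f i)) (hrun : IsRun f D P ℱ Z Q π)
    (i j : Fin k) (t : ℕ) : Measurable[ℱ t] (estExcess f Z Q i j t) :=
  ((measurable_pi_apply j).comp (hrun.measurable_estLoss hf t)).sub
    ((measurable_pi_apply i).comp (hrun.measurable_estLoss hf t))

omit [Finite C] [MeasurableSingletonClass C] [IsProbabilityMeasure P] in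
/-- A function of the past is independent of the current instance. -/
lemma IsRun.integral_mul_eq (hrun : IsRun f D P ℱ Z Q π) {t : ℕ} {W : Ω → ℝ}
    (hW : Measurable[ℱ t] W) {h : X × C → ℝ} (hh : Measurable h) :
    ∫ ω, W ω * h (Z (t + 1) ω) ∂P = (∫ ω, W ω ∂P) * ∫ z, h z ∂D := by
  have hZ : Measurable (Z (t + 1)) := (hrun.measurable_Z t).mono (ℱ.le _) le_rfl
  have hind : IndepFun W (fun ω => h (Z (t + 1) ω)) P := by
    rw [IndepFun_iff_Indep]
    refine indep_of_indep_of_le_left (indep_of_indep_of_le_right (hrun.indep_Z t).symm ?_)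
      hW.comap_le
    rw [← Function.comp_def, ← MeasurableSpace.comap_comp]
    exact MeasurableSpace.comap_mono hh.comap_le
  rw [hind.integral_fun_mul_eq_mul_integral
    (hW.mono (ℱ.le _) le_rfl).aestronglyMeasurable (hh.comp hZ).aestronglyMeasurable,
    ← hrun.law_Z t, integral_map hZ.aemeasurable hh.aestronglyMeasurable]

/-- Integrating a Bernoulli variable against its conditional success probability. -/
lemma integral_mul_eq_of_condExp_eq {m : MeasurableSpace Ω} (hm : m ≤ mΩ) {G B q : Ω → ℝ}
    (hG : StronglyMeasurable[m] G) {c : ℝ} (hGc : ∀ ω, |G ω| ≤ c) (hB : Integrable B P)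
    (hq : P[B|m] =ᵐ[P] q) : ∫ ω, G ω * B ω ∂P = ∫ ω, G ω * q ω ∂P := by
  have h1 := condExp_stronglyMeasurable_mul_of_bound (μ := P) hm hG hB c
    (Filter.Eventually.of_forall hGc)
  rw [← integral_condExp hm (f := fun ω => G ω * B ω)]
  refine integral_congr_ae ?_
  filter_upwards [h1, hq] with ω h1 h2
  rw [← h2]; exact h1

omit [Finite C] in
lemma integrable_excess [Countable C] [IsProbabilityMeasure D] (hf : ∀ i, Measurable (f i))
    (i j : Fin k) : Integrable (excess f i j) D :=
  Integrable.of_bound (measurable_excess hf i j).aestronglyMeasurable 1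
    (Filter.Eventually.of_forall fun z => abs_excess_le_one f i j z)

omit [Finite C] in
lemma integral_excess_sq [Countable C] (hf : ∀ i, Measurable (f i)) (i j : Fin k) :
    ∫ z, excess f i j z ^ 2 ∂D = disagreement f D i j := by
  simp_rw [excess_sq]
  rw [integral_indicator_const, disagreement, smul_eq_mul, mul_one]
  exact (measurableSet_eq_fun (measurable_loss hf j) (measurable_loss hf i)).compl

/-- The information available before the query decision of round `t + 1`. -/
abbrev nextInfo (ℱ : Filtration ℕ mΩ) (Z : ℕ → Ω → X × C) (t : ℕ) : MeasurableSpace Ω :=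
  (ℱ t : MeasurableSpace Ω) ⊔ MeasurableSpace.comap (Z (t + 1)) inferInstance

/-- Two averagings in turn: over the query decision given the past and the instance, which turns the
Bernoulli indicator into `q`, then over the instance, which is independent of the past. Between
them, `mul_exp_div_sub_one_le` removes `q` from the bound, leaving a function of the instance alone.
-/
lemma IsRun.integral_exp_estExcess_succ_le [IsProbabilityMeasure D]
    (hf : ∀ i, Measurable (f i)) (hrun : IsRun f D P ℱ Z Q π) (i j : Fin k) {a β : ℝ} {t : ℕ}
    (ha : 0 ≤ a) (hβ : 0 < β) (haβ : a ≤ β)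
    (ht : ∀ s < t + 1, β ≤ min 1 (learningRate k (s + 1))) :
    ∫ ω, Real.exp (-a * estExcess f Z Q i j (t + 1) ω) ∂P ≤
      (1 - a * gap f D i j + 3 / 4 * a ^ 2 / β * disagreement f D i j) *
        ∫ ω, Real.exp (-a * estExcess f Z Q i j t ω) ∂P := by
  classical
  have hZ : Measurable (Z (t + 1)) := (hrun.measurable_Z t).mono (ℱ.le _) le_rfl
  have hm : nextInfo ℱ Z t ≤ mΩ := sup_le (ℱ.le t) hZ.comap_le
  have hFm : (ℱ t : MeasurableSpace Ω) ≤ nextInfo ℱ Z t := le_sup_left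
  have hZm : Measurable[nextInfo ℱ Z t] (Z (t + 1)) :=
    (comap_measurable (Z (t + 1))).mono le_sup_right le_rfl
  have hqm : Measurable[nextInfo ℱ Z t] (nextQueryProb f Z Q t) :=
    measurable_roundQueryProb_comp hf (t + 1)
      ((hrun.measurable_estLoss hf t).mono hFm le_rfl) hZm
  set W : Ω → ℝ := fun ω => Real.exp (-a * estExcess f Z Q i j t ω) with hWdef
  set d : Ω → ℝ := fun ω => excess f i j (Z (t + 1) ω) with hddef
  set q : Ω → ℝ := nextQueryProb f Z Q t with hqdef
  set B : Ω → ℝ := fun ω => if Q (t + 1) ω then (1 : ℝ) else 0 with hBdef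
  set G : Ω → ℝ := fun ω => W ω * (Real.exp (-a * (d ω / q ω)) - 1) with hGdef
  have hWF : Measurable[ℱ t] W :=
    Real.measurable_exp.comp ((hrun.measurable_estExcess hf i j t).const_mul (-a))
  have hdm : Measurable[nextInfo ℱ Z t] d := (measurable_excess hf i j).comp hZm
  have hGm : Measurable[nextInfo ℱ Z t] G := (hWF.mono hFm le_rfl).mul
    ((Real.measurable_exp.comp ((hdm.div hqm).const_mul (-a))).sub_const 1)
  have hWb : ∀ ω, |W ω| ≤ Real.exp (a * (t / β)) := by
    intro ω
    rw [abs_of_pos (Real.exp_pos _)]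
    refine Real.exp_le_exp.2 ?_
    have h := neg_le_of_abs_le (abs_estExcess_le (f := f) (Z := Z) (Q := Q) hβ i j ω t
      fun s hs => ht s (hs.trans t.lt_succ_self))
    nlinarith
  have hGb : ∀ ω, |G ω| ≤ Real.exp (a * (t / β)) * (Real.exp (a * (1 / β)) + 1) := by
    intro ω
    rw [hGdef, abs_mul]
    refine mul_le_mul (hWb ω) ?_ (abs_nonneg _) (Real.exp_pos _).le
    refine (abs_sub _ _).trans ?_
    rw [abs_one, abs_of_pos (Real.exp_pos _)]
    refine add_le_add (Real.exp_le_exp.2 ?_) le_rfl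
    have h := neg_le_of_abs_le (abs_excess_div_nextQueryProb_le (f := f) (Z := Z) (Q := Q) hβ
      (ht t t.lt_succ_self) i j ω)
    nlinarith
  have hBm : Measurable B := Measurable.ite
    ((hrun.measurable_Q t).mono (ℱ.le _) le_rfl (measurableSet_singleton true))
    measurable_const measurable_const
  have hB1 : ∀ ω, ‖B ω‖ ≤ 1 := fun ω => by
    simp only [hBdef]; split_ifs <;> simp
  have hB : Integrable B P :=
    Integrable.of_bound hBm.aestronglyMeasurable 1 (Filter.Eventually.of_forall hB1)
  have hWi : Integrable W P := Integrable.of_bound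
    (hWF.mono (ℱ.le _) le_rfl).aestronglyMeasurable _ (Filter.Eventually.of_forall hWb)
  have hGi : Integrable (fun ω => G ω * B ω) P :=
    hB.bdd_mul (hGm.mono hm le_rfl).aestronglyMeasurable (Filter.Eventually.of_forall hGb)
  -- The query decision enters only through the factor `B`; `W` and `G` are known before it is
  -- drawn.
  have hsplit : ∀ ω, Real.exp (-a * estExcess f Z Q i j (t + 1) ω) = W ω + G ω * B ω := by
    intro ω
    rw [estExcess_succ]
    simp only [hGdef, hWdef, hBdef]
    split_ifs
    · rw [mul_add, Real.exp_add]; ring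
    · simp
  have hGq : ∫ ω, G ω * B ω ∂P = ∫ ω, G ω * q ω ∂P :=
    integral_mul_eq_of_condExp_eq hm hGm.stronglyMeasurable hGb hB (hrun.law_Q t)
  set h : X × C → ℝ := fun z => -a * excess f i j z + 3 / 4 * a ^ 2 / β * excess f i j z ^ 2
    with hhdef
  have hexm := measurable_excess hf i j
  have hhm : Measurable h := (hexm.const_mul _).add ((hexm.pow_const 2).const_mul _)
  have hhb : ∀ z, |h z| ≤ a + 3 / 4 * a ^ 2 / β := by
    intro z
    have h1 := abs_excess_le_one f i j z
    refine (abs_add_le _ _).trans (add_le_add ?_ ?_)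
    · rw [abs_mul, abs_neg, abs_of_nonneg ha]
      exact mul_le_of_le_one_right ha h1
    · rw [abs_mul, abs_of_nonneg (by positivity : 0 ≤ 3 / 4 * a ^ 2 / β), abs_pow]
      exact mul_le_of_le_one_right (by positivity) (pow_le_one₀ (abs_nonneg _) h1)
  have hpt : ∀ ω, G ω * q ω ≤ W ω * h (Z (t + 1) ω) := by
    intro ω
    have := mul_exp_div_sub_one_le (d := d ω) (q := q ω) hβ (abs_excess_le_one f i j _) ha haβ
      ((excess_eq_zero_or_le_roundQueryProb f i j (t + 1) _ (Z (t + 1) ω)).imp id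
        (ht t t.lt_succ_self).trans)
    rw [hGdef, mul_assoc]
    exact mul_le_mul_of_nonneg_left this (Real.exp_pos _).le
  have hWh : Integrable (fun ω => W ω * h (Z (t + 1) ω)) P :=
    hWi.mul_bdd (hhm.comp hZ).aestronglyMeasurable (Filter.Eventually.of_forall fun ω => hhb _)
  have hGq_int : Integrable (fun ω => G ω * q ω) P := by
    -- As a version of a conditional expectation, `q` is integrable without a separate upper bound.
    have hqi : Integrable q P := (integrable_condExp (f := B)).congr (hrun.law_Q t)
    exact hqi.bdd_mul (hGm.mono hm le_rfl).aestronglyMeasurable (Filter.Eventually.of_forall hGb)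
  have hhD : ∫ z, h z ∂D = -a * gap f D i j + 3 / 4 * a ^ 2 / β * disagreement f D i j := by
    have hi := integrable_excess (D := D) hf i j
    have hi2 : Integrable (fun z => excess f i j z ^ 2) D :=
      Integrable.of_bound (hexm.pow_const 2).aestronglyMeasurable 1
        (Filter.Eventually.of_forall fun z => by
          rw [Real.norm_eq_abs, abs_pow]
          exact pow_le_one₀ (abs_nonneg _) (abs_excess_le_one f i j z))
    rw [hhdef, integral_add (hi.const_mul _) (hi2.const_mul _), integral_const_mul,
      integral_const_mul, integral_excess_sq hf]
    rfl
  simp_rw [hsplit]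
  rw [integral_add hWi hGi, hGq]
  have hle := integral_mono hGq_int hWh hpt
  rw [hrun.integral_mul_eq hWF hhm, hhD] at hle
  linarith

lemma IsRun.integral_exp_estExcess_le [IsProbabilityMeasure D]
    (hf : ∀ i, Measurable (f i)) (hrun : IsRun f D P ℱ Z Q π) (i j : Fin k) {a β : ℝ}
    (ha : 0 ≤ a) (hβ : 0 < β) (haβ : a ≤ β) (t : ℕ)
    (ht : ∀ s < t, β ≤ min 1 (learningRate k (s + 1))) :
    ∫ ω, Real.exp (-a * estExcess f Z Q i j t ω) ∂P ≤
      Real.exp (-a * gap f D i j + 3 / 4 * a ^ 2 / β * disagreement f D i j) ^ t := by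
  induction t with
  | zero => simp [estExcess_zero]
  | succ t ih =>
    have hE := ih fun s hs => ht s (hs.trans t.lt_succ_self)
    have h0 : 0 ≤ ∫ ω, Real.exp (-a * estExcess f Z Q i j t ω) ∂P :=
      integral_nonneg fun ω => (Real.exp_pos _).le
    refine (hrun.integral_exp_estExcess_succ_le hf i j ha hβ haβ ht).trans ?_
    rw [pow_succ' (Real.exp _)]
    refine mul_le_mul ?_ hE h0 (Real.exp_pos _).le
    have := Real.add_one_le_exp (-a * gap f D i j + 3 / 4 * a ^ 2 / β * disagreement f D i j)
    linarith

omit [Finite C] in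
-- The excess takes values in `{-1, 0, 1}`, so it is at most its square. This makes `θ_j` positive,
-- keeps the Chernoff parameter below `β`, and yields `λ ≤ 1`.
lemma gap_le_disagreement [Countable C] [IsProbabilityMeasure D] (hf : ∀ i, Measurable (f i))
    (i j : Fin k) : gap f D i j ≤ disagreement f D i j := by
  rw [← integral_excess_sq hf i j]
  refine integral_mono (integrable_excess hf i j) ?_ fun z => ?_
  · exact Integrable.of_bound ((measurable_excess hf i j).pow_const 2).aestronglyMeasurable 1
        (Filter.Eventually.of_forall fun z => by
          rw [Real.norm_eq_abs, abs_pow]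
          exact pow_le_one₀ (abs_nonneg _) (abs_excess_le_one f i j z))
  · change excess f i j z ≤ _
    unfold excess loss
    rcases zeroOne_eq_zero_or_one (f j z.1) z.2 with h | h <;>
    rcases zeroOne_eq_zero_or_one (f i z.1) z.2 with h' | h' <;> simp [h, h']

/-- Concentration of the estimated losses: a bad expert is ahead with small probability. -/
lemma IsRun.measure_estExcess_nonpos_le [IsProbabilityMeasure D]
    (hf : ∀ i, Measurable (f i)) (hrun : IsRun f D P ℱ Z Q π) {i j : Fin k}
    (hij : 0 < gap f D i j) {β : ℝ} (hβ : 0 < β) (t : ℕ)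
    (ht : ∀ s < t, β ≤ min 1 (learningRate k (s + 1))) :
    P.real {ω | estExcess f Z Q i j t ω ≤ 0} ≤
      Real.exp (-(t * β * (gap f D i j ^ 2 / disagreement f D i j) / 3)) := by
  have hle := gap_le_disagreement (D := D) hf i j
  set Δ := gap f D i j with hΔ
  set θ := disagreement f D i j with hθ
  have hθ0 : 0 < θ := hij.trans_le hle
  -- Minimiser of `-aΔ + (3/4) a² θ/β`; the minimum is `-β Δ²/(3θ)`.
  set a := 2 / 3 * (Δ / θ) * β with ha
  have hr : Δ / θ ≤ 1 := (div_le_one hθ0).2 hle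
  have ha0 : 0 ≤ a := by positivity
  have haβ : a ≤ β := by
    rw [ha]; nlinarith [div_pos hij hθ0]
  have hmgf := hrun.integral_exp_estExcess_le hf i j ha0 hβ haβ t ht
  have hint : Integrable (fun ω => Real.exp (-a * estExcess f Z Q i j t ω)) P := by
    refine Integrable.of_bound (Real.measurable_exp.comp
      (((hrun.measurable_estExcess hf i j t).mono (ℱ.le t) le_rfl).const_mul
        (-a))).aestronglyMeasurable (Real.exp (a * (t / β)))
      (Filter.Eventually.of_forall fun ω => ?_)
    rw [Real.norm_eq_abs, abs_of_pos (Real.exp_pos _)]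
    refine Real.exp_le_exp.2 ?_
    have h := neg_le_of_abs_le (abs_estExcess_le (f := f) (Z := Z) (Q := Q) hβ i j ω t ht)
    nlinarith
  have hch := measure_le_le_exp_mul_mgf (μ := P) (X := estExcess f Z Q i j t) 0
    (neg_nonpos.2 ha0) hint
  rw [mul_zero, Real.exp_zero, one_mul, mgf] at hch
  refine hch.trans (hmgf.trans_eq ?_)
  rw [← Real.exp_nat_mul]
  congr 1
  rw [ha]
  field_simp
  ring

end Run

/-! ### From concentration to a constant regret bound -/

section Regret

lemma le_of_expWeights_le {k : ℕ} {η : ℝ} (hη : 0 < η) {L : Fin k → ℝ} {i j : Fin k}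
    (h : expWeights η L i ≤ expWeights η L j) : L j ≤ L i := by
  have hpos : 0 < ∑ m, Real.exp (-η * L m) :=
    Finset.sum_pos (fun _ _ => Real.exp_pos _) ⟨i, Finset.mem_univ i⟩
  have h' := Real.exp_le_exp.1 ((div_le_div_iff_of_pos_right hpos).1 h)
  nlinarith

lemma learningRate_pos {k t : ℕ} (hk : 2 ≤ k) (ht : 0 < t) : 0 < learningRate k t := by
  have : 0 < Real.log k := Real.log_pos (by exact_mod_cast hk)
  have : (0 : ℝ) < t := by exact_mod_cast ht
  exact Real.sqrt_pos.2 (by positivity)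

lemma natCast_mul_learningRate (k : ℕ) {t : ℕ} (ht : 0 < t) :
    t * learningRate k t = √(Real.log k / 2) * √(t : ℝ) := by
  have h0 : (0 : ℝ) < t := by exact_mod_cast ht
  have hl := Real.log_natCast_nonneg k
  rw [learningRate, ← div_div, Real.sqrt_div (by positivity)]
  have h1 := Real.mul_self_sqrt h0.le
  have h2 := Real.sqrt_pos.2 h0
  field_simp
  rw [sq, h1, mul_comm]

/-- Bounds the cost of the rounds where `η_t` may exceed 1. The constant 26 is what 62 leaves after
the 36 of the exponential sum; `log k ≤ k` and `(log k)² ≤ 4k` would already give 3. -/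
lemma log_div_two_add_one_le {k : ℕ} (hk : 2 ≤ k) :
    Real.log k / 2 + 1 ≤ 26 * (k / Real.log k) := by
  have hk' : (2 : ℝ) ≤ k := by exact_mod_cast hk
  have hl : 0 < Real.log k := Real.log_pos (by linarith)
  have h1 : Real.log k ≤ k := (Real.log_le_sub_one_of_pos (by linarith)).trans (by linarith)
  have h2 : Real.log k ≤ 2 * √(k : ℝ) := by
    have h := Real.log_le_sub_one_of_pos (Real.sqrt_pos.2 (by linarith : (0 : ℝ) < k))
    rw [Real.log_sqrt (by linarith)] at h
    linarith
  have h3 : Real.log k ^ 2 ≤ 4 * k := by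
    have := Real.sq_sqrt (by linarith : (0 : ℝ) ≤ k)
    nlinarith [Real.sqrt_nonneg (k : ℝ)]
  rw [mul_div_assoc', le_div_iff₀ hl]
  nlinarith

lemma sum_ite_two_mul_lt_le {x : ℝ} (hx : 0 ≤ x) (T : ℕ) :
    (∑ t ∈ Finset.range T, if 2 * (t : ℝ) < x then (1 : ℝ) else 0) ≤ x / 2 + 1 := by
  rw [Finset.sum_boole]
  have hsub : (Finset.range T).filter (fun t : ℕ => 2 * (t : ℝ) < x) ⊆
      Finset.range ⌈x / 2⌉₊ := by
    intro t ht
    rw [Finset.mem_filter] at ht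
    rw [Finset.mem_range, Nat.lt_ceil]
    linarith [ht.2]
  have h1 : ((Finset.card ((Finset.range T).filter (fun t : ℕ => 2 * (t : ℝ) < x)) : ℕ) : ℝ)
      ≤ (⌈x / 2⌉₊ : ℝ) := by
    exact_mod_cast (Finset.card_le_card hsub).trans_eq (Finset.card_range _)
  exact h1.trans (Nat.ceil_lt_add_one (by positivity)).le

variable {X C Ω : Type*} [MeasurableSpace X] [Finite C] [MeasurableSpace C]
    [MeasurableSingletonClass C] [mΩ : MeasurableSpace Ω] {k : ℕ} {f : Fin k → X → C}
    {D : Measure (X × C)} [IsProbabilityMeasure D] {P : Measure Ω} [IsProbabilityMeasure P]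
    {ℱ : Filtration ℕ mΩ} {Z : ℕ → Ω → X × C} {Q : ℕ → Ω → Bool} {π : ℕ → Ω → Fin k}

omit [MeasurableSpace X] [Finite C] [MeasurableSpace C] [MeasurableSingletonClass C] in
lemma abs_loss_le_one (f : Fin k → X → C) (i : Fin k) (z : X × C) : |loss f i z| ≤ 1 := by
  rw [loss, abs_of_nonneg (zeroOne_nonneg _ _)]; exact zeroOne_le_one _ _

omit [IsProbabilityMeasure D] in
-- The recommendation is a function of the past, hence independent of the instance on which it is
-- evaluated, so each event `π = j` factors out of the expected excess.
lemma IsRun.integral_loss_recommendation (hf : ∀ i, Measurable (f i))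
    (hrun : IsRun f D P ℱ Z Q π) (istar : Fin k) (t : ℕ) :
    Integrable (fun ω => loss f (π (t + 1) ω) (Z (t + 1) ω)) P ∧
    ∫ ω, loss f (π (t + 1) ω) (Z (t + 1) ω) ∂P =
      risk f D istar + ∑ j, P.real {ω | π (t + 1) ω = j} * gap f D istar j := by
  classical
  have hZ : Measurable (Z (t + 1)) := (hrun.measurable_Z t).mono (ℱ.le _) le_rfl
  have hset : ∀ j, MeasurableSet[ℱ t] {ω | π (t + 1) ω = j} := fun j =>
    hrun.measurable_π t (measurableSet_singleton j)
  set W : Fin k → Ω → ℝ := fun j => Set.indicator {ω | π (t + 1) ω = j} fun _ => 1 with hW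
  have hWm : ∀ j, Measurable[ℱ t] (W j) := by
    intro j
    simp only [hW]
    exact Measurable.indicator measurable_const (hset j)
  have hpt : ∀ ω, loss f (π (t + 1) ω) (Z (t + 1) ω) =
      loss f istar (Z (t + 1) ω) + ∑ j, W j ω * excess f istar j (Z (t + 1) ω) := by
    intro ω
    rw [Finset.sum_eq_single (π (t + 1) ω)]
    · simp [hW, excess]
    · intro j _ hj
      simp [hW, hj.symm]
    · simp
  have hi : Integrable (fun ω => loss f istar (Z (t + 1) ω)) P :=
    Integrable.of_bound ((measurable_loss hf istar).comp hZ).aestronglyMeasurable 1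
      (Filter.Eventually.of_forall fun ω => abs_loss_le_one f istar _)
  have hj : ∀ j ∈ Finset.univ,
      Integrable (fun ω => W j ω * excess f istar j (Z (t + 1) ω)) P := by
    intro j _
    refine Integrable.of_bound (((hWm j).mono (ℱ.le t) le_rfl).mul
      ((measurable_excess hf istar j).comp hZ)).aestronglyMeasurable 1
      (Filter.Eventually.of_forall fun ω => ?_)
    rw [norm_mul]
    refine mul_le_one₀ ?_ (norm_nonneg _) (abs_excess_le_one _ _ _ _)
    simp only [hW, Set.indicator]
    split_ifs <;> simp
  have hint := hi.add (integrable_finsetSum _ hj)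
  simp_rw [hpt]
  refine ⟨hint, ?_⟩
  rw [integral_add hi (integrable_finsetSum _ hj), integral_finsetSum _ hj]
  congr 1
  · have := hrun.integral_mul_eq (W := fun _ => (1 : ℝ)) (t := t) measurable_const
      (measurable_loss hf istar)
    simpa [risk] using this
  · refine Finset.sum_congr rfl fun j _ => ?_
    rw [hrun.integral_mul_eq (hWm j) (measurable_excess hf istar j)]
    congr 1
    rw [hW, integral_indicator_const _ (ℱ.le t _ (hset j)), smul_eq_mul, mul_one]

omit [Finite C] [MeasurableSingletonClass C] [IsProbabilityMeasure D] in
lemma gap_self (f : Fin k → X → C) (i : Fin k) : gap f D i i = 0 := by simp [gap]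

lemma sum_measure_eq_le_one {π : Ω → Fin k} (hπ : Measurable π) (s : Finset (Fin k)) :
    ∑ j ∈ s, P.real {ω | π ω = j} ≤ 1 := by
  have h := measureReal_biUnion_finset (μ := P) (s := s) (f := fun j => {ω | π ω = j})
    (fun i _ j _ hij => Set.disjoint_left.2 fun ω h1 h2 => hij (h1.symm.trans h2))
    (fun j _ => hπ (measurableSet_singleton j))
  rw [← h]
  exact measureReal_le_one

omit [Finite C] [MeasurableSingletonClass C] [IsProbabilityMeasure D] in
lemma hardness_le (f : Fin k → X → C) {istar j : Fin k} (hj : j ≠ istar) :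
    hardness f D istar ≤ gap f D istar j ^ 2 / disagreement f D istar j :=
  ciInf_le (f := fun j : {j : Fin k // j ≠ istar} =>
    gap f D istar j ^ 2 / disagreement f D istar j) (Set.finite_range _).bddBelow ⟨j, hj⟩

lemma hardness_pos (hf : ∀ i, Measurable (f i)) (hk : 2 ≤ k) {istar : Fin k}
    (hbest : ∀ j, j ≠ istar → 0 < gap f D istar j) : 0 < hardness f D istar := by
  have : Nontrivial (Fin k) := Fin.nontrivial_iff_two_le.2 hk
  obtain ⟨j, hj⟩ := exists_ne istar
  have : Nonempty {j : Fin k // j ≠ istar} := ⟨⟨j, hj⟩⟩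
  obtain ⟨⟨i, hi⟩, h⟩ := exists_eq_ciInf_of_finite
    (f := fun j : {j : Fin k // j ≠ istar} =>
      gap f D istar j ^ 2 / disagreement f D istar j)
  rw [hardness, ← h]
  exact div_pos (pow_pos (hbest i hi) 2)
    ((hbest i hi).trans_le (gap_le_disagreement hf istar i))

lemma hardness_le_one (hf : ∀ i, Measurable (f i)) (hk : 2 ≤ k) {istar : Fin k}
    (hbest : ∀ j, j ≠ istar → 0 < gap f D istar j) : hardness f D istar ≤ 1 := by
  have : Nontrivial (Fin k) := Fin.nontrivial_iff_two_le.2 hk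
  obtain ⟨j, hj⟩ := exists_ne istar
  have h1 := gap_le_disagreement (D := D) hf istar j
  have h2 : disagreement f D istar j ≤ 1 := measureReal_le_one
  have h3 := hbest j hj
  refine (hardness_le f hj).trans (div_le_one_of_le₀ ?_ (h3.le.trans h1))
  nlinarith

/-- The tail bound is applied with `β = η_t`, the smallest rate among the `t` rounds that built
`L̂_t`; the assumption `log k ≤ 2t` says that the cap at 1 is inactive for it. A union over at most
`k` models follows. -/
lemma IsRun.sum_measure_recommendation_ne_le (hf : ∀ i, Measurable (f i)) (hk : 2 ≤ k)
    (hrun : IsRun f D P ℱ Z Q π) {istar : Fin k}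
    (hbest : ∀ j, j ≠ istar → 0 < gap f D istar j) {t : ℕ} (ht0 : 0 < t)
    (ht : Real.log k ≤ 2 * t) :
    ∑ j ∈ Finset.univ.erase istar, P.real {ω | π (t + 1) ω = j} ≤
      k * Real.exp (-(hardness f D istar * √(Real.log k / 2) / 3 * √(t : ℝ))) := by
  have ht' : (0 : ℝ) < t := by exact_mod_cast ht0
  have hβ := learningRate_pos hk ht0
  have hβ1 : learningRate k t ≤ 1 := by
    rw [learningRate, Real.sqrt_le_one]
    exact div_le_one_of_le₀ ht (by positivity)
  have hj : ∀ j ∈ Finset.univ.erase istar, P.real {ω | π (t + 1) ω = j} ≤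
      Real.exp (-(hardness f D istar * √(Real.log k / 2) / 3 * √(t : ℝ))) := by
    intro j hj
    have hne : j ≠ istar := Finset.ne_of_mem_erase hj
    have hsub : {ω | π (t + 1) ω = j} ⊆ {ω | estExcess f Z Q istar j t ω ≤ 0} := by
      rintro ω rfl
      exact sub_nonpos.2
        (le_of_expWeights_le (learningRate_pos hk t.succ_pos) (hrun.argmax_π t ω istar))
    refine (measureReal_mono hsub).trans ((hrun.measure_estExcess_nonpos_le hf (hbest j hne) hβ t
      fun s hs => le_min hβ1 (learningRate_anti s.succ_pos hs)).trans ?_)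
    rw [natCast_mul_learningRate k ht0, Real.exp_le_exp, neg_le_neg_iff]
    have := mul_le_mul_of_nonneg_left (hardness_le (D := D) f hne)
      (by positivity : 0 ≤ √(Real.log k / 2) * √(t : ℝ))
    linarith
  refine (Finset.sum_le_card_nsmul _ _ _ hj).trans ?_
  rw [nsmul_eq_mul]
  refine mul_le_mul_of_nonneg_right ?_ (Real.exp_pos _).le
  exact_mod_cast (Finset.card_le_univ _).trans_eq (Fintype.card_fin k)

/-- The expected number of rounds in which the recommendation is not the best model. -/
lemma IsRun.sum_sum_measure_recommendation_ne_le (hf : ∀ i, Measurable (f i)) (hk : 2 ≤ k)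
    (hrun : IsRun f D P ℱ Z Q π) {istar : Fin k}
    (hbest : ∀ j, j ≠ istar → 0 < gap f D istar j) (T : ℕ) :
    ∑ t ∈ Finset.range T, ∑ j ∈ Finset.univ.erase istar, P.real {ω | π (t + 1) ω = j} ≤
      62 * (k / (hardness f D istar ^ 2 * Real.log k)) := by
  have hl : 0 < Real.log k := Real.log_pos (by exact_mod_cast hk)
  have hpos := hardness_pos (D := D) hf hk hbest
  have hone := hardness_le_one (D := D) hf hk hbest
  set lam := hardness f D istar with hlam
  set c := lam * √(Real.log k / 2) / 3 with hc
  have hc0 : 0 < c := by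
    have : 0 < √(Real.log k / 2) := Real.sqrt_pos.2 (by positivity)
    positivity
  have hc2 : c ^ 2 = lam ^ 2 * Real.log k / 18 := by
    rw [hc, div_pow, mul_pow, Real.sq_sqrt (by positivity)]; ring
  -- Early rounds get the trivial bound 1. Index `t = 0` is always among them, since `log k > 0`.
  have hround : ∀ t ∈ Finset.range T,
      ∑ j ∈ Finset.univ.erase istar, P.real {ω | π (t + 1) ω = j} ≤
      (if 2 * (t : ℝ) < Real.log k then (1 : ℝ) else 0) +
        if t = 0 then 0 else k * Real.exp (-(c * √(t : ℝ))) := by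
    intro t _
    by_cases h : 2 * (t : ℝ) < Real.log k
    · rw [if_pos h]
      have h1 := sum_measure_eq_le_one (P := P)
        ((hrun.measurable_π t).mono (ℱ.le t) le_rfl) (Finset.univ.erase istar)
      have h2 : (0 : ℝ) ≤ if t = 0 then 0 else k * Real.exp (-(c * √(t : ℝ))) := by
        split_ifs <;> positivity
      linarith
    · have ht0 : t ≠ 0 := by
        rintro rfl; simp at h; linarith
      rw [if_neg h, if_neg ht0, zero_add]
      exact hrun.sum_measure_recommendation_ne_le hf hk hbest (Nat.pos_of_ne_zero ht0)
        (not_lt.1 h)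
  have hexp : ∑ t ∈ Finset.range T, (if t = 0 then 0 else k * Real.exp (-(c * √(t : ℝ)))) ≤
      k * (2 / c ^ 2) := by
    -- One more nonnegative term is added so that dropping the zero term at `t = 0` leaves exactly
    -- the shifted sum over `range T`.
    calc _ ≤ ∑ t ∈ Finset.range (T + 1),
          (if t = 0 then 0 else k * Real.exp (-(c * √(t : ℝ)))) :=
        Finset.sum_le_sum_of_subset_of_nonneg (Finset.range_subset_range.2 T.le_succ)
          fun t _ _ => by split_ifs <;> positivity
      _ = k * ∑ t ∈ Finset.range T, Real.exp (-(c * √((t + 1 : ℕ) : ℝ))) := by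
        rw [Finset.sum_range_succ', Finset.mul_sum]; simp
      _ ≤ _ := mul_le_mul_of_nonneg_left (sum_exp_neg_mul_sqrt_le hc0 T) (Nat.cast_nonneg k)
  refine (Finset.sum_le_sum hround).trans ?_
  rw [Finset.sum_add_distrib]
  have h1 := sum_ite_two_mul_lt_le hl.le T
  have h2 := log_div_two_add_one_le hk
  -- Because `λ ≤ 1`, the cost of the early rounds is absorbed into the same expression.
  have h3 : (k : ℝ) / Real.log k ≤ k / (lam ^ 2 * Real.log k) :=
    div_le_div_of_nonneg_left (Nat.cast_nonneg k) (by positivity)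
      (mul_le_of_le_one_left hl.le (pow_le_one₀ hpos.le hone))
  have h4 : k * (2 / c ^ 2) = 36 * (k / (lam ^ 2 * Real.log k)) := by
    rw [hc2]; field_simp; norm_num
  linarith

end Regret

end ModelPicker

theorem mainTheorem6 {X C Ω : Type*} [MeasurableSpace X]
    [Finite C] [MeasurableSpace C] [MeasurableSingletonClass C] [mΩ : MeasurableSpace Ω]
    {k : ℕ} (hk : 2 ≤ k)
    (f : Fin k → X → C) (hf : ∀ i, Measurable (f i))
    (D : Measure (X × C)) [IsProbabilityMeasure D]
    (istar : Fin k) (hbest : ∀ j, j ≠ istar → 0 < ModelPicker.gap f D istar j)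
    (P : Measure Ω) [IsProbabilityMeasure P] (ℱ : Filtration ℕ mΩ)
    (Z : ℕ → Ω → X × C) (Q : ℕ → Ω → Bool) (π I : ℕ → Ω → Fin k)
    (hrun : ModelPicker.IsRun f D P ℱ Z Q π)
    (hI : ∀ t, 1 ≤ t → I t = π t) (T : ℕ) :
    ModelPicker.pseudoRegret f D P Z I istar T ≤
      62 * (k / (ModelPicker.hardness f D istar ^ 2 * Real.log k)) *
        ⨆ i, ModelPicker.gap f D istar i := by
  set M := ⨆ i, ModelPicker.gap f D istar i with hM
  have hMle : ∀ i, ModelPicker.gap f D istar i ≤ M := fun i =>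
    le_ciSup (Set.finite_range fun i => ModelPicker.gap f D istar i).bddAbove i
  have hM0 : 0 ≤ M := (ModelPicker.gap_self (D := D) f istar).symm.le.trans (hMle istar)
  have hround := fun t => hrun.integral_loss_recommendation hf istar t
  have hreg : ModelPicker.pseudoRegret f D P Z I istar T = ∑ t ∈ Finset.range T,
      ∑ j, P.real {ω | π (t + 1) ω = j} * ModelPicker.gap f D istar j := by
    have hsum : ∀ ω, ∑ t ∈ Finset.Icc 1 T, ModelPicker.loss f (I t ω) (Z t ω) =
        ∑ t ∈ Finset.range T, ModelPicker.loss f (π (t + 1) ω) (Z (t + 1) ω) := by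
      intro ω
      rw [Finset.range_eq_Ico, Finset.sum_Ico_add' (fun t => ModelPicker.loss f (π t ω) (Z t ω))]
      refine Finset.sum_congr (by ext t; simp) fun t ht => ?_
      rw [hI t (by simp at ht; omega)]
    rw [ModelPicker.pseudoRegret]
    simp_rw [hsum]
    rw [integral_finsetSum _ fun t _ => (hround t).1,
      Finset.sum_congr rfl fun t _ => (hround t).2, Finset.sum_add_distrib, Finset.sum_const,
      Finset.card_range, nsmul_eq_mul, add_sub_cancel_left]
  rw [hreg]
  refine le_trans ?_ (mul_le_mul_of_nonneg_right
    (hrun.sum_sum_measure_recommendation_ne_le hf hk hbest T) hM0)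
  rw [Finset.sum_mul]
  refine Finset.sum_le_sum fun t _ => ?_
  -- Recommending `i*` costs nothing, so only the wrong models are charged the maximal gap.
  rw [← Finset.add_sum_erase _ _ (Finset.mem_univ istar), ModelPicker.gap_self, mul_zero,
    zero_add, Finset.sum_mul]
  exact Finset.sum_le_sum fun j _ => mul_le_mul_of_nonneg_left (hMle j) measureReal_nonneg
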